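/- **Definitions.** A *Gromov manifold* $(X,\omega,J)$ is a smooth ($C^\infty$, Hausdorff, second countable, without boundary) manifold $X$ of real dimension $2n$ with a symplectic form $\omega$ and a smooth almost complex structure $J$ such that, for all non-zero tangent vectors $v,w$ at each point, $\omega(Jv,Jw)=\omega(v,w)$ and $\omega(Jv,v)>0$. It carries the Riemannian metric $\langle v,w\rangle=\omega(Jv,w)$. Let $\nabla$ be the Levi-Civita connection of this metric. The Hessian of a smooth function $f$ is the bilinear form given on vector fields by $(\mathrm{Hess}\,f)(V,W)=VWf-(\nabla_VW)f$. A subspace $P\subset T_xX$ is *Lagrangian* if $\dim P=n$ and $\omega|_P=0$. A smooth real-valued function $f$ on an open subset $N$ of $X$ is *Lagrangian plurisubharmonic* (Lag-psh) if $\mathrm{tr}\big((\mathrm{Hess}\,f)_x|_P\big)\ge 0$ for every $x\in N$ and every Lagrangian $P\subset T_xX$, the trace being taken with respect to the metric. The *Lagrangian hull* of a compact set $K\subset X$ is $$\widehat K=\{x\in X:\ f(x)\le \sup_K f\ \text{ for all smooth Lag-psh functions } f \text{ on } X\},$$ with $\sup_\emptyset f=-\infty$. **Theorem 9.2.** Let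 $(X,\omega,J)$ be a non-compact connected Gromov manifold. The following are equivalent. 1. For every compact set $K\subset X$, the Lagrangian hull $\widehat K$ is compact. 2. There is a smooth Lag-psh function $f:X\to\mathbb R$ that is a proper exhaustion function, i.e. $\{x\in X: f(x)\le c\}$ is compact for every $c\in\mathbb R$. 3. There are an open neighborhood $N$ of infinity in $X$ (an open set with compact complement) and a smooth Lag-psh function $v$ on $N$ such that $\lim_{x\to\infty}v(x)=+\infty$, i.e. for every $c\in\mathbb R$ there is a compact set $L\subset X$ with $X\setminus L\subset N$ and $v>c$ on $X\setminus L$. -/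

import Mathlib

open Bundle FiberBundle VectorField Filter Topology
open scoped Manifold ContDiff

noncomputable section

namespace Gromov

variable {E : Type*} [NormedAddCommGroup E] [NormedSpace ℝ E]
  {M : Type*} [TopologicalSpace M] [ChartedSpace E M]

/-! ### The Levi-Civita connection of a Riemannian metric -/

variable (E M) in
/-- A smooth Riemannian metric on the manifold `M` (modelled on `E`, without boundary). -/
abbrev Metric [IsManifold 𝓘(ℝ, E) ∞ M] : Type _ :=
  ContMDiffRiemannianMetric 𝓘(ℝ, E) ∞ E (fun x : M ↦ TangentSpace 𝓘(ℝ, E) x)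

section Riemannian

variable [IsManifold 𝓘(ℝ, E) ∞ M]

/-- The right-hand side of the Koszul formula
`2⟨∇_V W, Z⟩ = V⟨W, Z⟩ + W⟨V, Z⟩ - Z⟨V, W⟩ + ⟨[V, W], Z⟩ - ⟨[V, Z], W⟩ - ⟨[W, Z], V⟩`. -/
def koszul (g : Metric E M) (V W Z : Π x : M, TangentSpace 𝓘(ℝ, E) x) (x : M) : ℝ :=
  d% (fun y ↦ g.inner y (W y) (Z y)) x (V x)
    + d% (fun y ↦ g.inner y (V y) (Z y)) x (W x)
    - d% (fun y ↦ g.inner y (V y) (W y)) x (Z x)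
    + g.inner x (mlieBracket 𝓘(ℝ, E) V W x) (Z x)
    - g.inner x (mlieBracket 𝓘(ℝ, E) V Z x) (W x)
    - g.inner x (mlieBracket 𝓘(ℝ, E) W Z x) (V x)

theorem mdifferentiableAt_inner (g : Metric E M) {V W : Π x : M, TangentSpace 𝓘(ℝ, E) x} {x : M}
    (hV : MDiffAt (T% V) x) (hW : MDiffAt (T% W) x) :
    MDiffAt (fun y ↦ g.inner y (V y) (W y)) x := by
  have h := MDifferentiableAt.clm_bundle_apply₂ (F₁ := E) (F₂ := E) (F₃ := ℝ)
    (E₃ := Bundle.Trivial M ℝ) (g.contMDiff.mdifferentiableAt (x := x) (by simp)) hV hW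
  simp only [mdifferentiableAt_totalSpace] at h
  exact h.2

theorem flat_injective (g : Metric E M) (x : M) : Function.Injective (g.inner x) := by
  refine (injective_iff_map_eq_zero _).2 fun v hv ↦ ?_
  by_contra h
  have := g.pos x v h
  simp [hv] at this

theorem ext_inner (g : Metric E M) {x : M} {u v : TangentSpace 𝓘(ℝ, E) x}
    (h : ∀ w, g.inner x u w = g.inner x v w) : u = v :=
  flat_injective g x (ContinuousLinearMap.ext h)

theorem mdifferentiableAt_mvfderiv_apply {f : M → ℝ} {W : Π x : M, TangentSpace 𝓘(ℝ, E) x} {x : M}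
    (hf : ContMDiffAt 𝓘(ℝ, E) 𝓘(ℝ) 2 f x) (hW : MDiffAt (T% W) x) :
    MDiffAt (fun y ↦ d% f y (W y)) x := by
  have h1 := (hf.mfderiv_const (m := 1) (by norm_num)).mdifferentiableAt (by simp)
  have h2 := MDifferentiableAt.clm_apply_of_inCoordinates h1 hW (hf.mdifferentiableAt (by simp))
  simp only [mdifferentiableAt_totalSpace] at h2
  have h3 := h2.2
  simpa using! h3

variable [FiniteDimensional ℝ E]

theorem koszul_tensorial₁ (g : Metric E M) {W Z : Π x : M, TangentSpace 𝓘(ℝ, E) x} {x : M}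
    (hW : MDiffAt (T% W) x) (hZ : MDiffAt (T% Z) x) :
    TensorialAt 𝓘(ℝ, E) E (fun V ↦ koszul g V W Z x) x where
  smul {f V} hf hV := by
    have := FiniteDimensional.complete ℝ E
    simp [koszul, mvfderiv_fun_mul hf (mdifferentiableAt_inner g hV hZ),
      mvfderiv_fun_mul hf (mdifferentiableAt_inner g hV hW),
      mlieBracket_smul_left hf hV]
    rw [g.symm x (V x) (Z x), g.symm x (V x) (W x)]
    ring
  add {V V'} hV hV' := by
    have := FiniteDimensional.complete ℝ E
    simp [koszul,
      mvfderiv_fun_add (mdifferentiableAt_inner g hV hZ) (mdifferentiableAt_inner g hV' hZ),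
      mvfderiv_fun_add (mdifferentiableAt_inner g hV hW) (mdifferentiableAt_inner g hV' hW),
      mlieBracket_add_left hV hV']
    ring

theorem koszul_tensorial₃ (g : Metric E M) {V W : Π x : M, TangentSpace 𝓘(ℝ, E) x} {x : M}
    (hV : MDiffAt (T% V) x) (hW : MDiffAt (T% W) x) :
    TensorialAt 𝓘(ℝ, E) E (fun Z ↦ koszul g V W Z x) x where
  smul {f Z} hf hZ := by
    have := FiniteDimensional.complete ℝ E
    simp [koszul, mvfderiv_fun_mul hf (mdifferentiableAt_inner g hV hZ),
      mvfderiv_fun_mul hf (mdifferentiableAt_inner g hW hZ),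
      mlieBracket_smul_right hf hZ]
    rw [g.symm x (Z x) (V x), g.symm x (Z x) (W x)]
    ring
  add {Z Z'} hZ hZ' := by
    have := FiniteDimensional.complete ℝ E
    simp [koszul,
      mvfderiv_fun_add (mdifferentiableAt_inner g hV hZ) (mdifferentiableAt_inner g hV hZ'),
      mvfderiv_fun_add (mdifferentiableAt_inner g hW hZ) (mdifferentiableAt_inner g hW hZ'),
      mlieBracket_add_right hZ hZ']
    ring

theorem koszul_add (g : Metric E M) {V W W' Z : Π x : M, TangentSpace 𝓘(ℝ, E) x} {x : M}
    (hV : MDiffAt (T% V) x) (hW : MDiffAt (T% W) x) (hW' : MDiffAt (T% W') x)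
    (hZ : MDiffAt (T% Z) x) :
    koszul g V (W + W') Z x = koszul g V W Z x + koszul g V W' Z x := by
  have := FiniteDimensional.complete ℝ E
  simp [koszul,
      mvfderiv_fun_add (mdifferentiableAt_inner g hV hW) (mdifferentiableAt_inner g hV hW'),
      mvfderiv_fun_add (mdifferentiableAt_inner g hW hZ) (mdifferentiableAt_inner g hW' hZ),
      mlieBracket_add_right hW hW', mlieBracket_add_left hW hW']
  ring

theorem koszul_smul (g : Metric E M) {V W Z : Π x : M, TangentSpace 𝓘(ℝ, E) x} {f : M → ℝ} {x : M}
    (hf : MDiffAt f x)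
    (hV : MDiffAt (T% V) x) (hW : MDiffAt (T% W) x) (hZ : MDiffAt (T% Z) x) :
    koszul g V (f • W) Z x =
      f x * koszul g V W Z x + 2 * (d% f x (V x) * g.inner x (W x) (Z x)) := by
  have := FiniteDimensional.complete ℝ E
  simp [koszul, mvfderiv_fun_mul hf (mdifferentiableAt_inner g hV hW),
      mvfderiv_fun_mul hf (mdifferentiableAt_inner g hW hZ),
      mlieBracket_smul_right hf hW, mlieBracket_smul_left hf hW]
  rw [g.symm x (W x) (V x)]
  ring

instance (x : M) : FiniteDimensional ℝ (TangentSpace 𝓘(ℝ, E) x) :=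
  inferInstanceAs (FiniteDimensional ℝ E)

instance (x : M) : T2Space (TangentSpace 𝓘(ℝ, E) x) :=
  inferInstanceAs (T2Space E)

/-- The isomorphism `T_x M ≅ T_x^* M`, `v ↦ ⟨v, ·⟩`. -/
def flat (g : Metric E M) (x : M) :
    TangentSpace 𝓘(ℝ, E) x ≃L[ℝ] (TangentSpace 𝓘(ℝ, E) x →L[ℝ] ℝ) :=
  (LinearMap.linearEquivOfInjective (g.inner x).toLinearMap (flat_injective g x) (by
    rw [← (LinearMap.toContinuousLinearMap
      (E := TangentSpace 𝓘(ℝ, E) x) (F' := ℝ) (𝕜 := ℝ)).finrank_eq]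
    exact Subspace.dual_finrank_eq.symm)).toContinuousLinearEquiv

theorem flat_apply (g : Metric E M) (x : M) (v : TangentSpace 𝓘(ℝ, E) x) :
    flat g x v = g.inner x v := rfl

theorem inner_flat_symm (g : Metric E M) (x : M) (α : TangentSpace 𝓘(ℝ, E) x →L[ℝ] ℝ)
    (w : TangentSpace 𝓘(ℝ, E) x) : g.inner x ((flat g x).symm α) w = α w := by
  rw [← flat_apply, ContinuousLinearEquiv.apply_symm_apply]

open Classical in
/-- `leviCivitaFun g W x v` is the vector `∇_v W` determined by the Koszul formula, for a vector
field `W` that is differentiable at `x` (and `0` for other `W`). -/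
def leviCivitaFun (g : Metric E M) (W : Π x : M, TangentSpace 𝓘(ℝ, E) x) (x : M) :
    TangentSpace 𝓘(ℝ, E) x →L[ℝ] TangentSpace 𝓘(ℝ, E) x :=
  if hW : MDiffAt (T% W) x then
    ((flat g x).symm : _ →L[ℝ] TangentSpace 𝓘(ℝ, E) x).comp
      ((2⁻¹ : ℝ) • TensorialAt.mkHom₂ (fun V Z ↦ koszul g V W Z x) x
        (fun _ hZ ↦ koszul_tensorial₁ g hW hZ) (fun _ hV ↦ koszul_tensorial₃ g hV hW))
  else 0

theorem inner_leviCivitaFun (g : Metric E M) {V W Z : Π x : M, TangentSpace 𝓘(ℝ, E) x} {x : M}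
    (hV : MDiffAt (T% V) x) (hW : MDiffAt (T% W) x) (hZ : MDiffAt (T% Z) x) :
    2 * g.inner x (leviCivitaFun g W x (V x)) (Z x) = koszul g V W Z x := by
  rw [leviCivitaFun, dif_pos hW, ContinuousLinearMap.comp_apply]
  erw [inner_flat_symm]
  simp only [smul_apply, smul_eq_mul]
  rw [TensorialAt.mkHom₂_apply _ _ hV hZ]
  ring

/-- The Levi-Civita connection of `g`. -/
def leviCivita (g : Metric E M) :
    CovariantDerivative 𝓘(ℝ, E) E (fun x : M ↦ TangentSpace 𝓘(ℝ, E) x) where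
  toFun := leviCivitaFun g
  isCovariantDerivativeOnUniv :=
    { add := by
        intro W W' x hW hW' _
        ext v
        refine ext_inner g fun z ↦ ?_
        have hv := mdifferentiableAt_extend 𝓘(ℝ, E) E v
        have hz := mdifferentiableAt_extend 𝓘(ℝ, E) E z
        have h1 := inner_leviCivitaFun g hv hW hz
        have h2 := inner_leviCivitaFun g hv hW' hz
        have h3 := inner_leviCivitaFun g hv (mdifferentiableAt_add_section hW hW') hz
        have h4 := koszul_add g hv hW hW' hz
        simp only [extend_apply_self] at h1 h2 h3
        simp only [add_apply, map_add]
        have h5 : 2 * g.inner x (leviCivitaFun g (W + W') x v) z =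
          koszul g (extend E v) (W + W') (extend E z) x := h3
        linarith
      leibniz := by
        intro W f x hW hf _
        ext v
        refine ext_inner g fun z ↦ ?_
        have hv := mdifferentiableAt_extend 𝓘(ℝ, E) E v
        have hz := mdifferentiableAt_extend 𝓘(ℝ, E) E z
        have h1 := inner_leviCivitaFun g hv hW hz
        have h3 := inner_leviCivitaFun g hv (hf.smul_section hW) hz
        have h4 := koszul_smul g hf hv hW hz
        simp only [extend_apply_self] at h1 h3 h4
        have h5 : 2 * g.inner x (leviCivitaFun g (f • W) x v) z =
          koszul g (extend E v) (f • W) (extend E z) x := h3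
        simp only [add_apply, map_add, smul_apply,
          map_smul, ContinuousLinearMap.smulRight_apply, smul_eq_mul]
        linear_combination (1 / 2 : ℝ) * h5 + (1 / 2 : ℝ) * h4 - (1 / 2 : ℝ) * f x * h1 }

/-- The Levi-Civita connection is torsion-free. -/
theorem leviCivita_torsion [CompleteSpace E] (g : Metric E M) : (leviCivita g).torsion = 0 := by
  rw [CovariantDerivative.torsion_eq_zero_iff]
  intro V W x hV hW
  refine ext_inner g fun z ↦ ?_
  have hz := mdifferentiableAt_extend 𝓘(ℝ, E) E z
  have h1 := inner_leviCivitaFun g hV hW hz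
  have h2 := inner_leviCivitaFun g hW hV hz
  have h3 : ∀ y, g.inner y (V y) (W y) = g.inner y (W y) (V y) := fun y ↦ g.symm y _ _
  have h4 : mlieBracket 𝓘(ℝ, E) W V x = - mlieBracket 𝓘(ℝ, E) V W x := mlieBracket_swap_apply
  simp only [koszul, extend_apply_self, h3, h4, map_neg, neg_apply] at h1 h2
  simp only [leviCivita, map_sub, sub_apply]
  linarith

/-- The Levi-Civita connection is compatible with the metric. -/
theorem leviCivita_metric (g : Metric E M) {V W Z : Π x : M, TangentSpace 𝓘(ℝ, E) x} {x : M}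
    (hV : MDiffAt (T% V) x) (hW : MDiffAt (T% W) x) (hZ : MDiffAt (T% Z) x) :
    d% (fun y ↦ g.inner y (W y) (Z y)) x (V x) =
      g.inner x (leviCivita g W x (V x)) (Z x) + g.inner x (W x) (leviCivita g Z x (V x)) := by
  have h1 := inner_leviCivitaFun g hV hW hZ
  have h2 := inner_leviCivitaFun g hV hZ hW
  have h3 : ∀ y, g.inner y (Z y) (W y) = g.inner y (W y) (Z y) := fun y ↦ g.symm y _ _
  have h4 : mlieBracket 𝓘(ℝ, E) Z W x = - mlieBracket 𝓘(ℝ, E) W Z x := mlieBracket_swap_apply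
  simp only [koszul, h3, h4, map_neg, neg_apply] at h1 h2
  rw [g.symm x (W x)]
  simp only [leviCivita]
  linarith

/-! ### The Riemannian Hessian -/

/-- The Hessian on vector fields: `V W f - (∇_V W) f`. -/
def hessField (g : Metric E M) (f : M → ℝ) (V W : Π x : M, TangentSpace 𝓘(ℝ, E) x) (x : M) : ℝ :=
  d% (fun y ↦ d% f y (W y)) x (V x) - d% f x (leviCivita g W x (V x))

theorem hessField_tensorial₁ (g : Metric E M) (f : M → ℝ) (W : Π x : M, TangentSpace 𝓘(ℝ, E) x)
    (x : M) : TensorialAt 𝓘(ℝ, E) E (fun V ↦ hessField g f V W x) x where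
  smul _ _ := by simp [hessField]; ring
  add _ _ := by simp [hessField]; ring

theorem hessField_tensorial₂ (g : Metric E M) {f : M → ℝ} {x : M}
    (hf : ContMDiffAt 𝓘(ℝ, E) 𝓘(ℝ) 2 f x) (V : Π x : M, TangentSpace 𝓘(ℝ, E) x) :
    TensorialAt 𝓘(ℝ, E) E (fun W ↦ hessField g f V W x) x where
  smul {h W} hh hW := by
    simp [hessField, mvfderiv_fun_mul hh (mdifferentiableAt_mvfderiv_apply hf hW),
      (leviCivita g).isCovariantDerivativeOn.leibniz hW hh]
    ring
  add {W W'} hW hW' := by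
    simp [hessField, mvfderiv_fun_add (mdifferentiableAt_mvfderiv_apply hf hW)
      (mdifferentiableAt_mvfderiv_apply hf hW'),
      (leviCivita g).isCovariantDerivativeOn.add hW hW']
    ring

open Classical in
/-- The Hessian of `f` at `x` as a bilinear form on `T_x M`, for `f` of class `C²` at `x`
(and `0` for other `f`). It is characterised by `hess_apply`. -/
def hess (g : Metric E M) (f : M → ℝ) (x : M) :
    TangentSpace 𝓘(ℝ, E) x →L[ℝ] TangentSpace 𝓘(ℝ, E) x →L[ℝ] ℝ :=
  if hf : ContMDiffAt 𝓘(ℝ, E) 𝓘(ℝ) 2 f x then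
    TensorialAt.mkHom₂ (fun V W ↦ hessField g f V W x) x
      (fun W _ ↦ hessField_tensorial₁ g f W x) (fun V _ ↦ hessField_tensorial₂ g hf V)
  else 0

/-- `(Hess f)(V, W) = V W f - (∇_V W) f` for all differentiable vector fields `V` and `W`. -/
theorem hess_apply (g : Metric E M) {f : M → ℝ} {V W : Π x : M, TangentSpace 𝓘(ℝ, E) x} {x : M}
    (hf : ContMDiffAt 𝓘(ℝ, E) 𝓘(ℝ) 2 f x) (hV : MDiffAt (T% V) x) (hW : MDiffAt (T% W) x) :
    hess g f x (V x) (W x) =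
      d% (fun y ↦ d% f y (W y)) x (V x) - d% f x (leviCivita g W x (V x)) := by
  rw [hess, dif_pos hf, TensorialAt.mkHom₂_apply _ _ hV hW, hessField]

end Riemannian

/-! ### Gromov manifolds -/

section Structures

variable [IsManifold 𝓘(ℝ, E) ∞ M]

variable (E M) in
/-- A smooth almost complex structure on `M`. -/
structure AlmostComplexStructure where
  /-- the endomorphism of each tangent space -/
  J (x : M) : TangentSpace 𝓘(ℝ, E) x →L[ℝ] TangentSpace 𝓘(ℝ, E) x
  J_J (x : M) (v : TangentSpace 𝓘(ℝ, E) x) : J x (J x v) = -v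
  contMDiff_J : ContMDiff 𝓘(ℝ, E) (𝓘(ℝ, E).prod 𝓘(ℝ, E →L[ℝ] E)) ∞
    (fun x ↦ TotalSpace.mk' (E →L[ℝ] E)
      (E := fun x : M ↦ TangentSpace 𝓘(ℝ, E) x →L[ℝ] TangentSpace 𝓘(ℝ, E) x) x (J x))

variable (E M) in
/-- A symplectic form on `M`: a smooth, closed, nondegenerate 2-form. Closedness is expressed by
the invariant formula
`dω(U, V, W) = U ω(V, W) - V ω(U, W) + W ω(U, V) - ω([U, V], W) + ω([U, W], V) - ω([V, W], U)`. -/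
structure SymplecticForm where
  /-- the bilinear form on each tangent space -/
  form (x : M) : TangentSpace 𝓘(ℝ, E) x →L[ℝ] TangentSpace 𝓘(ℝ, E) x →L[ℝ] ℝ
  form_self (x : M) (v : TangentSpace 𝓘(ℝ, E) x) : form x v v = 0
  nondegenerate (x : M) (v : TangentSpace 𝓘(ℝ, E) x) (hv : ∀ w, form x v w = 0) : v = 0
  contMDiff_form : ContMDiff 𝓘(ℝ, E) (𝓘(ℝ, E).prod 𝓘(ℝ, E →L[ℝ] E →L[ℝ] ℝ)) ∞
    (fun x ↦ TotalSpace.mk' (E →L[ℝ] E →L[ℝ] ℝ)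
      (E := fun x : M ↦ TangentSpace 𝓘(ℝ, E) x →L[ℝ] TangentSpace 𝓘(ℝ, E) x →L[ℝ] ℝ) x (form x))
  closed (U V W : Π x : M, TangentSpace 𝓘(ℝ, E) x)
    (hU : CMDiff ∞ (T% U)) (hV : CMDiff ∞ (T% V)) (hW : CMDiff ∞ (T% W)) (x : M) :
    d% (fun y ↦ form y (V y) (W y)) x (U x) - d% (fun y ↦ form y (U y) (W y)) x (V x)
      + d% (fun y ↦ form y (U y) (V y)) x (W x)
      - form x (mlieBracket 𝓘(ℝ, E) U V x) (W x) + form x (mlieBracket 𝓘(ℝ, E) U W x) (V x)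
      - form x (mlieBracket 𝓘(ℝ, E) V W x) (U x) = 0

variable (E M) in
/-- The structure `(ω, J)` of a Gromov manifold on `M`: a symplectic form `ω` and an almost complex
structure `J` with `ω(Jv, Jw) = ω(v, w)` and `ω(Jv, v) > 0` for `v ≠ 0`. -/
structure GromovStructure extends SymplecticForm E M, AlmostComplexStructure E M where
  form_J_J (x : M) (v w : TangentSpace 𝓘(ℝ, E) x) : form x (J x v) (J x w) = form x v w
  form_J_pos (x : M) (v : TangentSpace 𝓘(ℝ, E) x) (hv : v ≠ 0) : 0 < form x (J x v) v

end Structures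

theorem isVonNBounded_of_pos [FiniteDimensional ℝ E] (B : E →L[ℝ] E →L[ℝ] ℝ)
    (hB : ∀ v, v ≠ 0 → 0 < B v v) : Bornology.IsVonNBounded ℝ {v : E | B v v < 1} := by
  rw [NormedSpace.isVonNBounded_iff]
  rcases subsingleton_or_nontrivial E with h | h
  · exact (Set.toFinite _).isBounded
  have := FiniteDimensional.proper ℝ E
  have hc : Continuous fun v : E ↦ B v v := B.continuous.clm_apply continuous_id
  obtain ⟨u, hu, hmin⟩ := (isCompact_sphere (0 : E) 1).exists_isMinOn
    (NormedSpace.sphere_nonempty.2 zero_le_one) (f := fun v ↦ B v v) hc.continuousOn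
  have hu0 : u ≠ 0 := by rintro rfl; simp at hu
  have hmpos : 0 < B u u := hB u hu0
  obtain ⟨m, hm⟩ : ∃ m, m = B u u := ⟨_, rfl⟩
  rw [← hm] at hmpos
  refine (Metric.isBounded_iff_subset_closedBall 0).2 ⟨1 + 1 / m, fun v hv ↦ ?_⟩
  rw [mem_closedBall_zero_iff]
  rcases eq_or_ne v 0 with rfl | hv0
  · simp; positivity
  have hn : 0 < ‖v‖ := norm_pos_iff.2 hv0
  have hs : ‖v‖⁻¹ • v ∈ Metric.sphere (0 : E) 1 := by simp [norm_smul, hn.ne']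
  have h1 : m ≤ B (‖v‖⁻¹ • v) (‖v‖⁻¹ • v) := hm ▸ hmin hs
  simp only [map_smul, smul_apply, smul_eq_mul] at h1
  have h2 : m * ‖v‖ ^ 2 ≤ B v v := by
    have := mul_le_mul_of_nonneg_right h1 (sq_nonneg ‖v‖)
    refine this.trans_eq ?_
    field_simp
  have h3 : B v v < 1 := hv
  have h4 : ‖v‖ ^ 2 ≤ 1 / m := by
    rw [le_div_iff₀ hmpos]; linarith
  nlinarith [sq_nonneg (‖v‖ - 1)]

namespace GromovStructure

variable [IsManifold 𝓘(ℝ, E) ∞ M] [FiniteDimensional ℝ E]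

/-- The Riemannian metric `⟨v, w⟩ = ω(Jv, w)` of a Gromov manifold. -/
def metric (S : GromovStructure E M) : Metric E M where
  inner x := (S.form x).comp (S.J x)
  symm x v w := by
    have h := S.form_J_J x (S.J x v) w
    have h1 := S.form_self x (v + S.J x w)
    simp only [map_add, add_apply, S.form_self, S.J_J, map_neg, neg_apply] at h h1
    simp only [ContinuousLinearMap.comp_apply]
    linarith
  pos x v hv := S.form_J_pos x v hv
  isVonNBounded x :=
    isVonNBounded_of_pos (E := E)
      (show E →L[ℝ] E →L[ℝ] ℝ from (S.form x).comp (S.J x)) (S.form_J_pos x)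
  contMDiff := by
    intro x
    have hJ := S.contMDiff_J x
    have hform := S.contMDiff_form x
    rw [contMDiffAt_hom_bundle] at hJ hform ⊢
    refine ⟨contMDiffAt_id, (hform.2.clm_comp hJ.2).congr_of_eventuallyEq ?_⟩
    filter_upwards [(trivializationAt E (TangentSpace 𝓘(ℝ, E) : M → Type _) x).open_baseSet.mem_nhds
      (FiberBundle.mem_baseSet_trivializationAt' x)] with y hy
    ext v w
    have key : ∀ z : TangentSpace 𝓘(ℝ, E) y,
        (trivializationAt E (TangentSpace 𝓘(ℝ, E) : M → Type _) x).symmL ℝ y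
          ((trivializationAt E (TangentSpace 𝓘(ℝ, E) : M → Type _) x).linearMapAt ℝ y z) = z :=
      fun z ↦ Bundle.Trivialization.symmₗ_linearMapAt _ hy z
    simp [ContinuousLinearMap.inCoordinates, key]

/-! ### Lagrangian plurisubharmonic functions and hulls -/

/-- `P ⊆ T_x M` is a Lagrangian plane: `ω` vanishes on `P`, and `dim P` is half of `dim M`. -/
def IsLagrangian (S : GromovStructure E M) (x : M)
    (P : Submodule ℝ (TangentSpace 𝓘(ℝ, E) x)) : Prop :=
  (∀ v ∈ P, ∀ w ∈ P, S.form x v w = 0) ∧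
    2 * Module.finrank ℝ P = Module.finrank ℝ (TangentSpace 𝓘(ℝ, E) x)

/-- `e` is an orthonormal basis of `P ⊆ T_x M`. -/
def IsOrthonormalBasisOf (S : GromovStructure E M) (x : M)
    (P : Submodule ℝ (TangentSpace 𝓘(ℝ, E) x))
    (e : Fin (Module.finrank ℝ P) → TangentSpace 𝓘(ℝ, E) x) : Prop :=
  (∀ i, e i ∈ P) ∧ ∀ i j, S.metric.inner x (e i) (e j) = if i = j then 1 else 0

/-- `tr (Hess f |_P) ≥ 0` for every Lagrangian plane `P ⊆ T_x M`, where the trace is the sum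
of `(Hess f)(eᵢ, eᵢ)` over an orthonormal basis `e` of `P`. -/
def IsLagPshAt (S : GromovStructure E M) (f : M → ℝ) (x : M) : Prop :=
  ∀ P : Submodule ℝ (TangentSpace 𝓘(ℝ, E) x), S.IsLagrangian x P →
    ∀ e, S.IsOrthonormalBasisOf x P e → 0 ≤ ∑ i, hess S.metric f x (e i) (e i)

/-- `f` is a smooth Lagrangian plurisubharmonic function on the open set `N`. -/
def IsSmoothLagPshOn (S : GromovStructure E M) (f : M → ℝ) (N : Set M) : Prop :=
  ContMDiffOn 𝓘(ℝ, E) 𝓘(ℝ) ∞ f N ∧ ∀ x ∈ N, S.IsLagPshAt f x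

/-- The cone of smooth Lagrangian plurisubharmonic functions on `M`. -/
def smoothLagPsh (S : GromovStructure E M) : Set (M → ℝ) :=
  {f | ContMDiff 𝓘(ℝ, E) 𝓘(ℝ) ∞ f ∧ ∀ x, S.IsLagPshAt f x}

/-- The Lagrangian hull of `K`; the supremum is taken in the extended reals. -/
def hull (S : GromovStructure E M) (K : Set M) : Set M :=
  {x | ∀ f ∈ S.smoothLagPsh, (f x : EReal) ≤ ⨆ y ∈ K, (f y : EReal)}

end GromovStructure

/-- `f` is a proper exhaustion function: its sublevel sets are compact. -/
def IsProperExhaustion {X : Type*} [TopologicalSpace X] (f : X → ℝ) : Prop :=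
  ∀ c : ℝ, IsCompact {x | f x ≤ c}

end Gromov

end

/-! Only formal properties of the cone of smooth Lag-psh functions are used: it is closed under
sums, under composition with smooth convex nondecreasing functions of one variable
(`comp_mem_smoothLagPsh`), and membership is local (`mem_smoothLagPsh_of_locally`). The composition
rule rests on Hess(φ∘f) = φ'(f) Hess f + φ''(f) df⊗df, whose rank-one term has nonnegative trace on
every plane. An exhaustion bounds hulls, since a hull lies in any sublevel set that contains K.
Conversely, if hulls are compact, exhaust X by compacts H_j with the hull of H_j inside the interior
of H_{j+1}. Cutoffs of functions violating the hull inequality give nonnegative h_j that vanish on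
H_j and are at least j on the next shell; their locally finite sum is an exhaustion. A function v
given only near infinity becomes global by composing it with a cutoff that kills its values on a
compact shell, then extending by zero. -/

namespace Gromov

/-! ### Convex cutoffs on the real line. -/

/-- Smooth convex nondecreasing functions that vanish up to `c` and are large from `c'` on. -/
theorem exists_smooth_convex_cutoff (a : ℝ) {c c' : ℝ} (hc : c < c') :
    ∃ φ : ℝ → ℝ, ContDiff ℝ ∞ φ ∧ (∀ t, 0 ≤ deriv φ t) ∧ (∀ t, 0 ≤ deriv (deriv φ) t) ∧
      (∀ t ≤ c, φ t = 0) ∧ (∀ t, 0 ≤ φ t) ∧ (∀ t, c' ≤ t → a ≤ φ t) ∧ Tendsto φ atTop atTop := by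
  have hcont : Continuous fun t : ℝ ↦ Real.smoothTransition (t - c) :=
    Real.smoothTransition.continuous.comp (continuous_id.sub continuous_const)
  -- A primitive of a smooth monotone step: F' ≥ 0 makes F nondecreasing, F' monotone makes it
  -- convex, and F' = 0 left of c makes it vanish there.
  obtain ⟨F, hF⟩ : ∃ F : ℝ → ℝ, F = fun t ↦ ∫ s in c..t, Real.smoothTransition (s - c) := ⟨_, rfl⟩
  have hF' (t : ℝ) : HasDerivAt F (Real.smoothTransition (t - c)) t := by
    rw [hF]
    exact intervalIntegral.integral_hasDerivAt_right (hcont.intervalIntegrable _ _)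
      (hcont.stronglyMeasurableAtFilter _ _) hcont.continuousAt
  have hdF : deriv F = fun t ↦ Real.smoothTransition (t - c) := funext fun t ↦ (hF' t).deriv
  have hFd : Differentiable ℝ F := fun t ↦ (hF' t).differentiableAt
  have hsmooth : ContDiff ℝ ∞ fun t : ℝ ↦ Real.smoothTransition (t - c) :=
    (Real.smoothTransition.contDiff (n := ⊤)).comp (contDiff_id.sub contDiff_const)
  have hFs : ContDiff ℝ ∞ F := by
    rw [contDiff_infty_iff_deriv]
    exact ⟨hFd, hdF ▸ hsmooth⟩
  have hmono : Monotone F := monotone_of_deriv_nonneg hFd fun t ↦ by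
    rw [hdF]; exact Real.smoothTransition.nonneg _
  have hdmono : Monotone (deriv F) := by
    rw [hdF]
    exact fun s t hst ↦ Real.smoothTransition.monotone (sub_le_sub_right hst c)
  have hF0 : F c = 0 := by simp [hF]
  have hpos : 0 < F c' := by
    rw [hF]
    refine intervalIntegral.intervalIntegral_pos_of_pos_on (hcont.intervalIntegrable _ _)
      (fun t ht ↦ Real.smoothTransition.pos_of_pos (sub_pos.2 ht.1)) hc
  have hzero (t : ℝ) (ht : t ≤ c) : F t = 0 := by
    rw [hF]
    refine (intervalIntegral.integral_congr (g := fun _ ↦ (0 : ℝ)) fun s hs ↦ ?_).trans (by simp)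
    rw [Set.uIcc_of_ge ht] at hs
    exact Real.smoothTransition.zero_of_nonpos (sub_nonpos.2 hs.2)
  have hnonneg (t : ℝ) : 0 ≤ F t := by
    rcases le_total t c with h | h
    · rw [hzero t h]
    · exact hF0 ▸ hmono h
  have htop : Tendsto F atTop atTop := by
    -- The step equals 1 beyond c + 1, so F grows there with slope 1.
    refine tendsto_atTop_mono' atTop (f₁ := fun t ↦ t - (c + 1)) ?_
      (tendsto_atTop_add_const_right _ _ tendsto_id)
    filter_upwards [eventually_ge_atTop (c + 1)] with t ht
    have h := intervalIntegral.integral_add_adjacent_intervals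
      (hcont.intervalIntegrable (μ := MeasureTheory.volume) c (c + 1))
      (hcont.intervalIntegrable (c + 1) t)
    have h1 : ∫ s in (c + 1)..t, Real.smoothTransition (s - c) = t - (c + 1) := by
      refine (intervalIntegral.integral_congr (g := fun _ ↦ (1 : ℝ)) fun s hs ↦ ?_).trans (by simp)
      rw [Set.uIcc_of_le ht] at hs
      exact Real.smoothTransition.one_of_one_le (by linarith [hs.1])
    have h2 := hnonneg (c + 1)
    rw [hF] at h2 ⊢
    simp only at h2 ⊢
    linarith
  -- Rescaling reaches the height a at c'. Using |a| + 1 keeps b positive whatever the sign of a.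
  obtain ⟨b, hb, hab⟩ : ∃ b : ℝ, 0 < b ∧ a ≤ b * F c' := by
    refine ⟨(|a| + 1) / F c', by positivity, ?_⟩
    rw [div_mul_cancel₀ _ hpos.ne']
    linarith [le_abs_self a]
  have hd1 : deriv (fun t ↦ b * F t) = fun t ↦ b * deriv F t :=
    funext fun t ↦ deriv_const_mul b (hFd t)
  have hd2 (t : ℝ) : deriv (fun t ↦ b * deriv F t) t = b * deriv (deriv F) t :=
    deriv_const_mul b (hdF ▸ hsmooth.differentiable (by simp) t)
  refine ⟨fun t ↦ b * F t, contDiff_const.mul hFs, fun t ↦ ?_, fun t ↦ ?_, fun t ht ↦ ?_,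
    fun t ↦ mul_nonneg hb.le (hnonneg t), fun t ht ↦ ?_, htop.const_mul_atTop hb⟩
  · rw [hd1]; exact mul_nonneg hb.le hmono.deriv_nonneg
  · rw [hd1, hd2]; exact mul_nonneg hb.le hdmono.deriv_nonneg
  · simp [hzero t ht]
  · exact hab.trans (mul_le_mul_of_nonneg_left (hmono ht) hb.le)

/-! ### Hessians of germs, sums and compositions. -/

variable {E : Type*} [NormedAddCommGroup E] [NormedSpace ℝ E]
  {M : Type*} [TopologicalSpace M] [ChartedSpace E M]

theorem mvfderiv_eq_of_eventuallyEq {f f' : M → ℝ} {x : M} (h : f =ᶠ[𝓝 x] f') :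
    mvfderiv 𝓘(ℝ, E) f x = mvfderiv 𝓘(ℝ, E) f' x := by
  ext v
  simp only [mvfderiv, ContinuousLinearMap.comp_apply, h.mfderiv_eq]
  rw [h.eq_of_nhds]
  rfl

theorem mvfderiv_comp_real {f : M → ℝ} {φ : ℝ → ℝ} {x : M} (hφ : DifferentiableAt ℝ φ (f x))
    (hf : MDifferentiableAt 𝓘(ℝ, E) 𝓘(ℝ) f x) (v : TangentSpace 𝓘(ℝ, E) x) :
    mvfderiv 𝓘(ℝ, E) (fun y ↦ φ (f y)) x v = deriv φ (f x) * mvfderiv 𝓘(ℝ, E) f x v := by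
  have h := (hφ.hasDerivAt.hasFDerivAt.hasMFDerivAt.comp x hf.hasMFDerivAt).mfderiv
  have h2 : mvfderiv 𝓘(ℝ, E) (fun y ↦ φ (f y)) x v = mfderiv 𝓘(ℝ, E) 𝓘(ℝ) (φ ∘ f) x v := rfl
  rw [h2, h]
  exact mul_comm _ _

variable [IsManifold 𝓘(ℝ, E) ∞ M]

theorem eventually_mdifferentiableAt {f : M → ℝ} {x : M}
    (hf : ContMDiffAt 𝓘(ℝ, E) 𝓘(ℝ) 2 f x) :
    ∀ᶠ y in 𝓝 x, MDifferentiableAt 𝓘(ℝ, E) 𝓘(ℝ) f y :=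
  (contMDiffAt_iff_contMDiffAt_nhds (by simp)).1 hf |>.mono fun _ hy ↦ hy.mdifferentiableAt (by simp)

variable [FiniteDimensional ℝ E]

/-- By tensoriality the Hessian may be computed on any extensions of the two vectors. Identities for
Hessians thus reduce to calculus of scalar functions. -/
theorem hess_extend (g : Metric E M) {f : M → ℝ} {x : M}
    (hf : ContMDiffAt 𝓘(ℝ, E) 𝓘(ℝ) 2 f x) (v w : TangentSpace 𝓘(ℝ, E) x) :
    hess g f x v w = mvfderiv 𝓘(ℝ, E) (fun y ↦ mvfderiv 𝓘(ℝ, E) f y (extend E w y)) x v -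
      mvfderiv 𝓘(ℝ, E) f x (leviCivita g (extend E w) x v) := by
  have h := hess_apply g hf (mdifferentiableAt_extend 𝓘(ℝ, E) E v)
    (mdifferentiableAt_extend 𝓘(ℝ, E) E w)
  simpa only [extend_apply_self] using h

theorem hess_eq_of_eventuallyEq (g : Metric E M) {f f' : M → ℝ} {x : M}
    (hf : ContMDiffAt 𝓘(ℝ, E) 𝓘(ℝ) 2 f x) (h : f =ᶠ[𝓝 x] f') : hess g f x = hess g f' x := by
  ext v w
  rw [hess_extend g hf, hess_extend g (hf.congr_of_eventuallyEq h.symm)]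
  rw [mvfderiv_eq_of_eventuallyEq h]
  congr 2
  refine mvfderiv_eq_of_eventuallyEq ?_
  -- A second derivative needs the first derivatives to agree near x, not only at x; equality of
  -- germs at x passes to nearby points.
  filter_upwards [h.eventuallyEq_nhds] with y hy
  rw [mvfderiv_eq_of_eventuallyEq hy]

theorem hess_add (g : Metric E M) {f f' : M → ℝ} {x : M}
    (hf : ContMDiffAt 𝓘(ℝ, E) 𝓘(ℝ) 2 f x) (hf' : ContMDiffAt 𝓘(ℝ, E) 𝓘(ℝ) 2 f' x) :
    hess g (f + f') x = hess g f x + hess g f' x := by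
  ext v w
  have hw := mdifferentiableAt_extend 𝓘(ℝ, E) E w
  rw [add_apply, add_apply, hess_extend g (hf.add hf'), hess_extend g hf, hess_extend g hf',
    mvfderiv_add (hf.mdifferentiableAt (by simp)) (hf'.mdifferentiableAt (by simp))]
  have h : (fun y ↦ mvfderiv 𝓘(ℝ, E) (f + f') y (extend E w y)) =ᶠ[𝓝 x]
      (fun y ↦ mvfderiv 𝓘(ℝ, E) f y (extend E w y)) +
        fun y ↦ mvfderiv 𝓘(ℝ, E) f' y (extend E w y) := by
    filter_upwards [eventually_mdifferentiableAt hf, eventually_mdifferentiableAt hf'] with y hy hy'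
    rw [mvfderiv_add hy hy']
    rfl
  rw [mvfderiv_eq_of_eventuallyEq h, mvfderiv_add (mdifferentiableAt_mvfderiv_apply hf hw)
    (mdifferentiableAt_mvfderiv_apply hf' hw)]
  simp only [add_apply]
  ring

/-- Near x, W(φ∘f) = (φ'∘f)·Wf. Differentiating this product along V produces the φ'' term, while
the connection term merely acquires the factor φ'(f x). -/
theorem hess_comp_real (g : Metric E M) {f : M → ℝ} {φ : ℝ → ℝ} {x : M}
    (hf : ContMDiffAt 𝓘(ℝ, E) 𝓘(ℝ) 2 f x) (hφ : ContDiff ℝ 2 φ)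
    (v w : TangentSpace 𝓘(ℝ, E) x) :
    hess g (fun y ↦ φ (f y)) x v w = deriv φ (f x) * hess g f x v w +
      deriv (deriv φ) (f x) * (mvfderiv 𝓘(ℝ, E) f x v * mvfderiv 𝓘(ℝ, E) f x w) := by
  have hw := mdifferentiableAt_extend 𝓘(ℝ, E) E w
  have hfx : MDifferentiableAt 𝓘(ℝ, E) 𝓘(ℝ) f x := hf.mdifferentiableAt (by simp)
  have hφd : Differentiable ℝ φ := hφ.differentiable (by simp)
  have hφ' : Differentiable ℝ (deriv φ) :=
    ((contDiff_succ_iff_deriv (n := 1)).1 hφ).2.2.differentiable (by simp)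
  have h : (fun y ↦ mvfderiv 𝓘(ℝ, E) (fun z ↦ φ (f z)) y (extend E w y)) =ᶠ[𝓝 x]
      (fun y ↦ deriv φ (f y)) * fun y ↦ mvfderiv 𝓘(ℝ, E) f y (extend E w y) := by
    filter_upwards [eventually_mdifferentiableAt hf] with y hy
    exact mvfderiv_comp_real (hφd _) hy _
  have hd : MDifferentiableAt 𝓘(ℝ, E) 𝓘(ℝ) (fun y ↦ deriv φ (f y)) x :=
    (hφ' (f x)).mdifferentiableAt.comp x hfx
  have hφf : ContMDiffAt 𝓘(ℝ, E) 𝓘(ℝ) 2 (fun y ↦ φ (f y)) x := hφ.comp_contMDiffAt hf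
  rw [hess_extend g hφf, hess_extend g hf, mvfderiv_eq_of_eventuallyEq h,
    mvfderiv_mul hd (mdifferentiableAt_mvfderiv_apply hf hw), mvfderiv_comp_real (hφd _) hfx]
  simp only [add_apply, smul_apply, smul_eq_mul, mvfderiv_comp_real (hφ' _) hfx,
    extend_apply_self]
  ring

end Gromov

namespace Gromov.GromovStructure

variable {E : Type*} [NormedAddCommGroup E] [NormedSpace ℝ E] [FiniteDimensional ℝ E]
  {M : Type*} [TopologicalSpace M] [ChartedSpace E M] [IsManifold 𝓘(ℝ, E) ∞ M]
  {S : GromovStructure E M}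

theorem two_le_infty : (2 : WithTop ℕ∞) ≤ ∞ := WithTop.coe_le_coe.2 le_top

/-! ### Operations on Lagrangian plurisubharmonic functions -/

theorem IsLagPshAt.congr_of_eventuallyEq {f f' : M → ℝ} {x : M} (hf : S.IsLagPshAt f x)
    (hfs : ContMDiffAt 𝓘(ℝ, E) 𝓘(ℝ) ∞ f x) (h : f =ᶠ[𝓝 x] f') : S.IsLagPshAt f' x := by
  intro P hP e he
  rw [← hess_eq_of_eventuallyEq S.metric (hfs.of_le (m := 2) two_le_infty) h]
  exact hf P hP e he

/-- The trace becomes φ'(f x) times the trace of Hess f, plus φ''(f x) times a sum of squares of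
df(e_i). -/
theorem IsLagPshAt.comp_real {f : M → ℝ} {φ : ℝ → ℝ} {x : M} (hf : S.IsLagPshAt f x)
    (hfs : ContMDiffAt 𝓘(ℝ, E) 𝓘(ℝ) ∞ f x) (hφ : ContDiff ℝ ∞ φ) (h1 : 0 ≤ deriv φ (f x))
    (h2 : 0 ≤ deriv (deriv φ) (f x)) : S.IsLagPshAt (fun y ↦ φ (f y)) x := by
  intro P hP e he
  simp only [hess_comp_real S.metric (hfs.of_le (m := 2) two_le_infty)
    (hφ.of_le (m := 2) two_le_infty), Finset.sum_add_distrib, ← Finset.mul_sum]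
  exact add_nonneg (mul_nonneg h1 (hf P hP e he))
    (mul_nonneg h2 (Finset.sum_nonneg fun i _ ↦ mul_self_nonneg _))

theorem IsLagPshAt.add {f f' : M → ℝ} {x : M} (hf : S.IsLagPshAt f x)
    (hfs : ContMDiffAt 𝓘(ℝ, E) 𝓘(ℝ) ∞ f x) (hf' : S.IsLagPshAt f' x)
    (hfs' : ContMDiffAt 𝓘(ℝ, E) 𝓘(ℝ) ∞ f' x) : S.IsLagPshAt (f + f') x := by
  intro P hP e he
  simp only [hess_add S.metric (hfs.of_le (m := 2) two_le_infty)
    (hfs'.of_le (m := 2) two_le_infty), add_apply, Finset.sum_add_distrib]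
  exact add_nonneg (hf P hP e he) (hf' P hP e he)

theorem isLagPshAt_zero (x : M) : S.IsLagPshAt (0 : M → ℝ) x := by
  intro P hP e he
  have hs : ContMDiffAt 𝓘(ℝ, E) 𝓘(ℝ) 2 (0 : M → ℝ) x := contMDiffAt_const
  have h : hess S.metric (0 : M → ℝ) x = 0 := by
    -- Additivity applied to 0 + 0 gives Hess 0 = 2 Hess 0.
    have h2 := hess_add S.metric hs hs
    rw [add_zero] at h2
    ext v w
    have h3 := congr($h2 v w)
    simp only [add_apply] at h3
    simpa using! h3
  simp [h]

theorem zero_mem_smoothLagPsh : (0 : M → ℝ) ∈ S.smoothLagPsh :=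
  ⟨contMDiff_const, isLagPshAt_zero⟩

theorem add_mem_smoothLagPsh {f f' : M → ℝ} (hf : f ∈ S.smoothLagPsh) (hf' : f' ∈ S.smoothLagPsh) :
    f + f' ∈ S.smoothLagPsh :=
  ⟨hf.1.add hf'.1, fun x ↦ (hf.2 x).add (hf.1 x) (hf'.2 x) (hf'.1 x)⟩

theorem sum_mem_smoothLagPsh {ι : Type*} {h : ι → M → ℝ} (hh : ∀ i, h i ∈ S.smoothLagPsh)
    (s : Finset ι) : ∑ i ∈ s, h i ∈ S.smoothLagPsh := by
  classical
  induction s using Finset.induction_on with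
  | empty => simpa using zero_mem_smoothLagPsh
  | insert i s hi ih =>
    rw [Finset.sum_insert hi]
    exact add_mem_smoothLagPsh (hh i) ih

theorem comp_mem_smoothLagPsh {f : M → ℝ} {φ : ℝ → ℝ} (hf : f ∈ S.smoothLagPsh)
    (hφ : ContDiff ℝ ∞ φ) (h1 : ∀ t, 0 ≤ deriv φ t) (h2 : ∀ t, 0 ≤ deriv (deriv φ) t) :
    (fun y ↦ φ (f y)) ∈ S.smoothLagPsh :=
  ⟨hφ.comp_contMDiff hf.1, fun x ↦ (hf.2 x).comp_real (hf.1 x) hφ (h1 _) (h2 _)⟩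

/-- This is the gluing principle behind both locally finite sums and extension by zero. -/
theorem mem_smoothLagPsh_of_locally {f : M → ℝ}
    (hf : ∀ x, ∃ f', f' =ᶠ[𝓝 x] f ∧ ContMDiffAt 𝓘(ℝ, E) 𝓘(ℝ) ∞ f' x ∧ S.IsLagPshAt f' x) :
    f ∈ S.smoothLagPsh := by
  refine ⟨fun x ↦ ?_, fun x ↦ ?_⟩ <;> obtain ⟨f', h, hs, hp⟩ := hf x
  · exact hs.congr_of_eventuallyEq h.symm
  · exact hp.congr_of_eventuallyEq hs h

/-! ### Hulls and exhaustion functions -/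

theorem subset_hull (K : Set M) : K ⊆ S.hull K := fun x hx f _ ↦
  le_iSup₂ (f := fun y (_ : y ∈ K) ↦ (f y : EReal)) x hx

theorem isClosed_hull (K : Set M) : IsClosed (S.hull K) := by
  have h : S.hull K = ⋂ f ∈ S.smoothLagPsh, {x | (f x : EReal) ≤ ⨆ y ∈ K, (f y : EReal)} := by
    ext x
    simp [hull]
  rw [h]
  exact isClosed_biInter fun f hf ↦
    isClosed_le (continuous_coe_real_ereal.comp hf.1.continuous) continuous_const

theorem isCompact_hull_of_exhaustion {f : M → ℝ} (hf : f ∈ S.smoothLagPsh)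
    (hex : IsProperExhaustion f) {K : Set M} (hK : IsCompact K) : IsCompact (S.hull K) := by
  obtain ⟨c, hc⟩ := hK.bddAbove_image hf.1.continuous.continuousOn
  refine (hex c).of_isClosed_subset (isClosed_hull K) fun x hx ↦ ?_
  have h : (f x : EReal) ≤ c := (hx f hf).trans <| iSup₂_le fun y hy ↦
    EReal.coe_le_coe_iff.2 (hc (Set.mem_image_of_mem f hy))
  exact EReal.coe_le_coe_iff.1 h

/-- Compact sets away from the hull of `K` are separated from `K` by Lagrangian plurisubharmonic
functions. -/
theorem exists_smoothLagPsh_separating {K L : Set M} (hL : IsCompact L)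
    (hd : Disjoint L (S.hull K)) (a : ℝ) :
    ∃ h ∈ S.smoothLagPsh, (∀ x, 0 ≤ h x) ∧ (∀ x ∈ K, h x = 0) ∧ ∀ x ∈ L, a ≤ h x := by
  -- Compactness reduces the claim to a neighborhood of each point: since the separating functions
  -- are nonnegative, adding two of them handles a union.
  refine hL.induction_on (p := fun L ↦ ∃ h ∈ S.smoothLagPsh, (∀ x, 0 ≤ h x) ∧
    (∀ x ∈ K, h x = 0) ∧ ∀ x ∈ L, a ≤ h x) ?_ ?_ ?_ ?_
  · exact ⟨0, zero_mem_smoothLagPsh, by simp, by simp, by simp⟩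
  · rintro s t hst ⟨h, hp, h0, hK, ht⟩
    exact ⟨h, hp, h0, hK, fun x hx ↦ ht x (hst hx)⟩
  · rintro s t ⟨h, hp, h0, hK, hs⟩ ⟨h', hp', h0', hK', ht⟩
    refine ⟨h + h', add_mem_smoothLagPsh hp hp', fun x ↦ add_nonneg (h0 x) (h0' x),
      fun x hx ↦ by simp [hK x hx, hK' x hx], ?_⟩
    rintro x (hx | hx)
    · exact (hs x hx).trans (le_add_of_nonneg_right (h0' x))
    · exact (ht x hx).trans (le_add_of_nonneg_left (h0 x))
  · intro x hx
    have hxK : x ∉ S.hull K := fun h ↦ Set.disjoint_left.1 hd hx h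
    simp only [hull, Set.mem_ofPred_eq, not_forall, not_le] at hxK
    obtain ⟨f, hf, hlt⟩ := hxK
    -- Two real levels fit between sup_K f and f x, even when K is empty and the supremum is -∞. The
    -- cutoff vanishes up to c, hence on K, and is at least a on the open set where f > c'.
    obtain ⟨c, hc, hcf⟩ := EReal.lt_iff_exists_real_btwn.1 hlt
    obtain ⟨c', hcc', hc'f⟩ := exists_between (EReal.coe_lt_coe_iff.1 hcf)
    obtain ⟨φ, hφ, h1, h2, hφ0, hφn, hφa, -⟩ := exists_smooth_convex_cutoff a hcc'
    refine ⟨{y | c' < f y}, mem_nhdsWithin_of_mem_nhds <|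
      (isOpen_lt continuous_const hf.1.continuous).mem_nhds hc'f, _,
      comp_mem_smoothLagPsh hf hφ h1 h2, fun _ ↦ hφn _, fun y hy ↦ hφ0 _ ?_,
      fun y hy ↦ hφa _ (le_of_lt hy)⟩
    have h : (f y : EReal) ≤ c :=
      (le_iSup₂ (f := fun y (_ : y ∈ K) ↦ (f y : EReal)) y hy).trans hc.le
    exact EReal.coe_le_coe_iff.1 h

/-- Each compact is chosen to absorb both the hull of its predecessor, compact by hypothesis, and a
member of a fixed exhaustion, so that the union is all of M. -/
theorem exists_hull_convex_exhaustion [LocallyCompactSpace M] [SigmaCompactSpace M]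
    (hS : ∀ K : Set M, IsCompact K → IsCompact (S.hull K)) :
    ∃ H : CompactExhaustion M, ∀ j, S.hull (H j) ⊆ interior (H (j + 1)) := by
  have C : CompactExhaustion M := default
  have step (j : ℕ) (K : {K : Set M // IsCompact K}) : ∃ K' : {K : Set M // IsCompact K},
      C j ∪ S.hull K.1 ⊆ interior K'.1 := by
    obtain ⟨K', hK', h⟩ := exists_compact_superset ((C.isCompact j).union (hS K.1 K.2))
    exact ⟨⟨K', hK'⟩, h⟩
  choose next hnext using step
  let H : ℕ → {K : Set M // IsCompact K} := Nat.rec ⟨∅, isCompact_empty⟩ next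
  have hH (j : ℕ) : C j ∪ S.hull (H j).1 ⊆ interior (H (j + 1)).1 := hnext j (H j)
  refine ⟨⟨fun j ↦ (H j).1, fun j ↦ (H j).2,
    fun j ↦ (subset_hull _).trans (Set.subset_union_right.trans (hH j)), ?_⟩,
    fun j ↦ Set.subset_union_right.trans (hH j)⟩
  refine Set.eq_univ_of_forall fun x ↦ ?_
  obtain ⟨j, hj⟩ := C.exists_mem x
  exact Set.mem_iUnion.2 ⟨j + 1, interior_subset (hH j (Or.inl hj))⟩

/-- The shell H_{j+2} \ int H_{j+1} misses the hull of H_j, so some h_j vanishes on H_j and is at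
least j on the shell. On H_k only the terms with j < k survive, so the sum is locally finite. -/
theorem exists_exhaustion_of_isCompact_hull [T2Space M] [LocallyCompactSpace M]
    [SigmaCompactSpace M] (hS : ∀ K : Set M, IsCompact K → IsCompact (S.hull K)) :
    ∃ f ∈ S.smoothLagPsh, IsProperExhaustion f := by
  obtain ⟨H, hH⟩ := exists_hull_convex_exhaustion hS
  have hsep (j : ℕ) : ∃ h ∈ S.smoothLagPsh, (∀ x, 0 ≤ h x) ∧ (∀ x ∈ H j, h x = 0) ∧
      ∀ x ∈ H (j + 2) \ interior (H (j + 1)), (j : ℝ) ≤ h x :=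
    exists_smoothLagPsh_separating ((H.isCompact _).diff isOpen_interior)
      (Set.disjoint_left.2 fun x hx hx' ↦ hx.2 (hH j hx')) j
  choose h hp h0 hK hL using hsep
  have hsupp {x : M} {k : ℕ} (hx : x ∈ H k) :
      (Function.support fun j ↦ h j x) ⊆ (Finset.range k : Finset ℕ) := fun j hj ↦ by
    by_contra hjk
    exact hj (hK j x (H.subset (by simpa using hjk) hx))
  have hsum {x : M} {k : ℕ} (hx : x ∈ H k) : ∑ᶠ j, h j x = (∑ j ∈ Finset.range k, h j) x := by
    rw [finsum_eq_sum_of_support_subset _ (hsupp hx), Finset.sum_apply]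
  have hmem : (fun x ↦ ∑ᶠ j, h j x) ∈ S.smoothLagPsh := by
    refine mem_smoothLagPsh_of_locally fun x ↦ ?_
    obtain ⟨k, hk⟩ := H.exists_mem_nhds x
    have hs := sum_mem_smoothLagPsh hp (Finset.range k)
    refine ⟨_, ?_, hs.1 x, hs.2 x⟩
    filter_upwards [hk] with y hy using (hsum hy).symm
  refine ⟨_, hmem, fun c ↦ ?_⟩
  obtain ⟨m, hm⟩ := exists_nat_gt c
  refine (H.isCompact (m + 1)).of_isClosed_subset
    (isClosed_le hmem.1.continuous continuous_const) fun x hx ↦ ?_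
  by_contra hxm
  -- A point outside H_{m+1} lies in the shell of index j = `H.find x` - 2 ≥ m, where h_j alone
  -- already exceeds c.
  have hfind : m + 1 < H.find x := by
    by_contra hle
    exact hxm (H.mem_iff_find_le.2 (not_lt.1 hle))
  obtain ⟨j, hj⟩ : ∃ j, H.find x = j + 2 := ⟨H.find x - 2, by omega⟩
  have hx1 : x ∉ H (j + 1) := fun hmem ↦ by
    have := H.mem_iff_find_le.1 hmem
    omega
  have hx2 : x ∈ H (j + 2) := hj ▸ H.mem_find x
  have hle := hL j x ⟨hx2, fun hi ↦ hx1 (interior_subset hi)⟩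
  have hle' : h j x ≤ ∑ᶠ i, h i x :=
    single_le_finsum j ((Finset.finite_toSet _).subset (hsupp hx2)) fun i ↦ h0 i x
  have hmj : (m : ℝ) ≤ j := by
    exact_mod_cast (by omega : m ≤ j)
  have hxc : ∑ᶠ i, h i x ≤ c := hx
  linarith

theorem exists_exhaustion_of_exhaustion_near_infinity [T2Space M] [LocallyCompactSpace M]
    {N : Set M} (hN : IsOpen N) (hNc : IsCompact Nᶜ) {v : M → ℝ} (hv : S.IsSmoothLagPshOn v N)
    (hlim : Tendsto v (cocompact M) atTop) :
    ∃ f ∈ S.smoothLagPsh, IsProperExhaustion f := by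
  classical
  -- Two nested compacts leave a collar: v is smooth off int L, and L lies inside int L'.
  obtain ⟨L, hL, hNL⟩ := exists_compact_superset hNc
  obtain ⟨L', hL', hLL'⟩ := exists_compact_superset hL
  have hsub {x : M} (hx : x ∉ interior L) : x ∈ N := by
    by_contra h
    exact hx (hNL h)
  have hvs {x : M} (hx : x ∈ N) : ContMDiffAt 𝓘(ℝ, E) 𝓘(ℝ) ∞ v x :=
    hv.1.contMDiffAt (hN.mem_nhds hx)
  obtain ⟨c, hc⟩ := (hL'.diff isOpen_interior).bddAbove_image (f := v)
    fun x hx ↦ (hvs (hsub hx.2)).continuousAt.continuousWithinAt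
  -- Since v ≤ c on the collar L' \ int L, φ∘v vanishes there and extends by zero across L. Only the
  -- growth of φ at infinity matters further, so the height 0 and the level c + 1 are arbitrary.
  obtain ⟨φ, hφ, h1, h2, hφ0, -, -, hφt⟩ := exists_smooth_convex_cutoff 0 (lt_add_one c)
  have hmem : (fun x ↦ if x ∈ L then 0 else φ (v x)) ∈ S.smoothLagPsh := by
    refine mem_smoothLagPsh_of_locally fun x ↦ ?_
    by_cases hx : x ∈ L
    · refine ⟨0, ?_, contMDiff_const x, isLagPshAt_zero x⟩
      filter_upwards [isOpen_interior.mem_nhds (hLL' hx)] with y hy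
      split_ifs with hyL
      · rfl
      · exact (hφ0 _ (hc ⟨y, ⟨interior_subset hy, fun h ↦ hyL (interior_subset h)⟩, rfl⟩)).symm
    · have hxN : x ∈ N := hsub fun h ↦ hx (interior_subset h)
      refine ⟨fun y ↦ φ (v y), ?_, hφ.comp_contMDiffAt (hvs hxN),
        (hv.2 x hxN).comp_real (hvs hxN) hφ (h1 _) (h2 _)⟩
      filter_upwards [hL.isClosed.isOpen_compl.mem_nhds hx] with y hy
      rw [if_neg hy]
  refine ⟨_, hmem, fun b ↦ ?_⟩
  obtain ⟨K, hK, hKb⟩ := mem_cocompact.1 ((hφt.comp hlim).eventually_gt_atTop b)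
  refine (hK.union hL).of_isClosed_subset (isClosed_le hmem.1.continuous continuous_const)
    fun x hx ↦ ?_
  by_contra hxKL
  have hxK : b < φ (v x) := hKb fun h ↦ hxKL (Or.inl h)
  have hxL : x ∉ L := fun h ↦ hxKL (Or.inr h)
  simp only [Set.mem_ofPred_eq, if_neg hxL] at hx
  linarith

end Gromov.GromovStructure

theorem Gromov.IsProperExhaustion.tendsto_cocompact {X : Type*} [TopologicalSpace X] {f : X → ℝ}
    (hf : IsProperExhaustion f) : Tendsto f (cocompact X) atTop :=
  tendsto_atTop.2 fun c ↦ mem_cocompact.2 ⟨_, hf c, fun _ hx ↦ le_of_lt (by simpa using hx)⟩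

theorem theorem9p2 {n : ℕ} {X : Type*} [TopologicalSpace X] [T2Space X] [SecondCountableTopology X]
    [ConnectedSpace X] [NoncompactSpace X] [ChartedSpace (EuclideanSpace ℝ (Fin (2 * n))) X]
    [IsManifold (𝓡 (2 * n)) ∞ X]
    (S : Gromov.GromovStructure (EuclideanSpace ℝ (Fin (2 * n))) X) :
    List.TFAE [
      ∀ K : Set X, IsCompact K → IsCompact (S.hull K),
      ∃ f ∈ S.smoothLagPsh, Gromov.IsProperExhaustion f,
      ∃ N : Set X, IsOpen N ∧ IsCompact Nᶜ ∧
        ∃ v : X → ℝ, S.IsSmoothLagPshOn v N ∧ Tendsto v (cocompact X) atTop] := by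
  -- Finite-dimensional charts give local compactness; together with second countability this yields
  -- σ-compactness, hence compact exhaustions.
  have : LocallyCompactSpace X :=
    ChartedSpace.locallyCompactSpace (EuclideanSpace ℝ (Fin (2 * n))) X
  tfae_have 1 → 2 := Gromov.GromovStructure.exists_exhaustion_of_isCompact_hull
  tfae_have 2 → 1 := fun ⟨_, hf, hex⟩ _ hK ↦
    Gromov.GromovStructure.isCompact_hull_of_exhaustion hf hex hK
  tfae_have 2 → 3 := fun ⟨f, hf, hex⟩ ↦
    ⟨Set.univ, isOpen_univ, by simp, f, ⟨hf.1.contMDiffOn, fun x _ ↦ hf.2 x⟩,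
      hex.tendsto_cocompact⟩
  tfae_have 3 → 2 := fun ⟨_, hN, hNc, _, hv, hlim⟩ ↦
    Gromov.GromovStructure.exists_exhaustion_of_exhaustion_near_infinity hN hNc hv hlim
  tfae_finish
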